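/- For $m\ge 1$, a $\mathrm{MOD}_m$ gate has unbounded fan-in (parallel wires are allowed) and outputs $1$ exactly when the sum of its $0/1$ inputs is divisible by $m$. A circuit of the form $\mathrm{MOD}_{a}\circ\mathrm{MOD}_{b}\circ\mathrm{MOD}_{c}$ is a layered depth-$3$ circuit with a single $\mathrm{MOD}_a$ output gate, which reads a middle layer of $\mathrm{MOD}_b$ gates, which read a bottom layer of $\mathrm{MOD}_c$ gates, which read the input bits. The size of a circuit is the number of its gates plus the number of its wires. A function $f:\{0,1\}^n\to\{0,1\}$ is symmetric if $f(x)$ depends only on the number of ones in $x$. Theorem. For every real $\varepsilon>0$ there are $k\ge 2$ and distinct primes $p_1,\ldots,p_k$ with product $m=p_1p_2\cdots p_k$, and a constant $c>0$, all depending only on $\varepsilon$, such that $$m\le\max\{30,(1/\varepsilon)^{2/\varepsilon}\}\ \text{ if } \varepsilon\le\tfrac12,\qquad m\le\max\{6,(1/\varepsilon)^{2/\varepsilon}\}\ \text{ if } \varepsilon>\tfrac12,$$ and for every $n\ge 1$, every symmetric function on $n$ bits is computed by a circuit of the form $\mathrm{MOD}_m\circ\mathrm{MOD}_m\circ\mathrm{MOD}_m$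 (a depth-$3$ $\mathrm{MOD}_m$ circuit) of size at most $\exp(c\,n^{\varepsilon})$, and also by a circuit of the form $\mathrm{MOD}_{p_1}\circ\mathrm{MOD}_{p_2\cdots p_k}\circ\mathrm{MOD}_{p_1}$ of size at most $\exp(c\,n^{\varepsilon})$. In particular $m\le(1/\varepsilon)^{2/\varepsilon}$ whenever $0<\varepsilon\le 0.45$ (and also for $0.5<\varepsilon\le 0.58$). -/

import Mathlib

/-- The number of ones in a Boolean vector. -/
def hammingWeight {n : ℕ} (x : Fin n → Bool) : ℕ := ∑ i, (x i).toNat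

/-- A Boolean function is symmetric if its value depends only on the number of ones
in the input. -/
def IsSymmetricFn {n : ℕ} (f : (Fin n → Bool) → Bool) : Prop :=
  ∀ x y : Fin n → Bool, hammingWeight x = hammingWeight y → f x = f y

/-- The `MOD_m` gate of unbounded fan-in whose `j`-th possible source is wired to it
`w j` times (parallel wires are allowed): it outputs `1` exactly when the sum of its inputs
is divisible by `m`. -/
def modGate (m : ℕ) {k : ℕ} (w : Fin k → ℕ) (x : Fin k → Bool) : Bool :=
  decide (m ∣ ∑ j, w j * (x j).toNat)

/-- `ModCircuit n [m₁, …, m_d] s` is the type of layered circuits of the form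
`MOD_{m₁} ∘ ⋯ ∘ MOD_{m_d}` on `n` input bits, with `s` gates in the top layer `MOD_{m₁}`.
The moduli are listed from the output layer down to the layer nearest the inputs. Every gate of
the bottom layer reads input bits only, every gate of a higher layer reads gates of the layer
just below only, and the depth of the circuit is the length of the list. The number `w i j` is
the number of wires from the `j`-th node of the previous layer to the `i`-th gate of the
new layer. -/
inductive ModCircuit (n : ℕ) : List ℕ → ℕ → Type
  | inputs : ModCircuit n [] n
  | layer {L : List ℕ} {t : ℕ} (C : ModCircuit n L t) (m s : ℕ) (w : Fin s → Fin t → ℕ) :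
      ModCircuit n (m :: L) s

namespace ModCircuit

/-- The outputs of the gates of the top layer on the input `x`. -/
def eval {n : ℕ} (x : Fin n → Bool) :
    {L : List ℕ} → {s : ℕ} → ModCircuit n L s → Fin s → Bool
  | _, _, inputs => x
  | _, _, layer C m _ w => fun i => modGate m (w i) (C.eval x)

/-- The size of a circuit: the number of its gates plus the number of its wires, parallel wires
being counted with multiplicity. -/
def size {n : ℕ} : {L : List ℕ} → {s : ℕ} → ModCircuit n L s → ℕ
  | _, _, inputs => 0
  | _, _, layer C _ s w => C.size + s + ∑ i, ∑ j, w i j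

end ModCircuit

/-- `f` is computed by a circuit of the form `MOD_{m₁} ∘ ⋯ ∘ MOD_{m_d}`, where
`L = [m₁, …, m_d]`, with a single output gate and of size at most `S`. -/
def HasModCircuit {n : ℕ} (L : List ℕ) (f : (Fin n → Bool) → Bool) (S : ℝ) : Prop :=
  ∃ C : ModCircuit n L 1, (∀ x, C.eval x 0 = f x) ∧ (C.size : ℝ) ≤ S

/-! ### A circuit from weights -/

/-! Let the primes be the first `r + 1` ones, with `1 < ε * (r + 1)`, let `M` be the product of the
odd ones, and let `z` be the number of zeros of the input. Powers of the primes slightly above `n ^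
(1 / (r + 1))` have product larger than `n`, so `z` is determined by its residues modulo them.

Modulo `p`, the indicator of a class of `z` modulo `p ^ e` is a combination of the binomials
`z.choose j` with `j < p ^ e` (`exists_choose_expansion`), and `z.choose j` is the sum of the NORs
of all `j`-sets of inputs. Modulo the odd number `M`, a NOR is a combination of parities, because 2
is invertible (`norInd_mem_paritySpan`). Hence for each `v` and each small set `S` there is a vector
`y` over `ZMod M`, with entries in the span of small parities, that vanishes exactly when `x` is
zero on `S` and `z ≡ v` modulo every odd prime power.

The conjunction `y = 0` has to be passed to a `MOD_2` gate. Over a finite reduced ring of odd order,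
the number of linear forms taking an idempotent value at `y` is odd if and only if `y = 0`
(`sum_isIdempotentElem_dotProduct`). Each test "form = `a`" with `a` idempotent is one `MOD_M` gate
reading parities. The output gate adds these tests modulo 2, with coefficients that expand the
indicator of `z ≡ v` modulo `2 ^ e` into NORs. This yields the indicator of `z = v`, and then a sum
over the relevant `v` (`exists_middle_weights`).

The sets have size `O(n ^ (1 / (r + 1)))`, so the circuit has size `exp (O(n ^ (1 / (r + 1)) * log
n))`, and the slack in the exponent absorbs the logarithm. The bound on the product of the primes
follows from a Chebyshev estimate. -/

theorem ModCircuit.exists_three_layer {n : ℕ} {B A : Type*} [Fintype B] [Fintype A]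
    (a b c W : ℕ) (u : B → Fin n → ℕ) (w : A → B → ℕ) (t : A → ℕ)
    (hu : ∀ β j, u β j ≤ W) (hw : ∀ α β, w α β ≤ W) (ht : ∀ α, t α ≤ W)
    (f : (Fin n → Bool) → Bool)
    (hf : ∀ x, f x = modGate a (fun i => t ((Fintype.equivFin A).symm i)) (fun i =>
      decide (b ∣ ∑ β, w ((Fintype.equivFin A).symm i) β *
        (decide (c ∣ ∑ j, u β j * (x j).toNat)).toNat))) (S : ℝ)
    (hS : ((Fintype.card B + Fintype.card B * (n * W)) +
      (Fintype.card A + Fintype.card A * (Fintype.card B * W)) +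
      (1 + Fintype.card A * W) : ℕ) ≤ S) :
    HasModCircuit [a, b, c] f S := by
  refine ⟨((ModCircuit.inputs.layer c (Fintype.card B)
    (fun i => u ((Fintype.equivFin B).symm i))).layer b (Fintype.card A)
    (fun i j => w ((Fintype.equivFin A).symm i) ((Fintype.equivFin B).symm j))).layer a 1
    (fun _ j => t ((Fintype.equivFin A).symm j)), fun x => ?_, le_trans ?_ hS⟩
  · rw [hf]
    simp only [ModCircuit.eval]
    congr 1
    funext i
    simp only [modGate]
    congr 2
    rw [← (Fintype.equivFin B).symm.sum_comp]
  · norm_cast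
    simp only [ModCircuit.size, zero_add]
    have h1 : ∑ i, ∑ j, u ((Fintype.equivFin B).symm i) j ≤ Fintype.card B * (n * W) := by
      refine (Finset.sum_le_card_nsmul _ _ (n * W) fun i _ => ?_).trans (by simp)
      exact (Finset.sum_le_card_nsmul _ _ W fun j _ => hu _ _).trans (by simp)
    have h2 : ∑ i, ∑ j, w ((Fintype.equivFin A).symm i) ((Fintype.equivFin B).symm j) ≤
        Fintype.card A * (Fintype.card B * W) := by
      refine (Finset.sum_le_card_nsmul _ _ (Fintype.card B * W) fun i _ => ?_).trans (by simp)
      exact (Finset.sum_le_card_nsmul _ _ W fun j _ => hw _ _).trans (by simp)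
    have h3 : ∑ _i : Fin 1, ∑ j, t ((Fintype.equivFin A).symm j) ≤ Fintype.card A * W := by
      simp only [Finset.univ_unique, Finset.sum_const, Finset.card_singleton, one_smul]
      exact (Finset.sum_le_card_nsmul _ _ W fun j _ => ht _).trans (by simp)
    omega

/-- Multiplying every wire by `a'` turns a `MOD_a` gate into an equivalent gate of modulus `a * a'`.
This is how circuits with mixed moduli become circuits with the single modulus `m`. -/
theorem mul_dvd_sum_mul_iff {ι : Type*} (s : Finset ι) {a' : ℕ} (ha : 0 < a') (a : ℕ)
    (f g : ι → ℕ) : a * a' ∣ ∑ i ∈ s, a' * f i * g i ↔ a ∣ ∑ i ∈ s, f i * g i := by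
  simp_rw [mul_assoc, ← Finset.mul_sum, mul_comm a a']
  exact Nat.mul_dvd_mul_iff_left ha

/-- The same weights, suitably scaled, give a circuit with all moduli equal to a common
multiple `m` of the three moduli. -/
theorem ModCircuit.exists_three_layer_pair {n : ℕ} {B A : Type*} [Fintype B] [Fintype A]
    (a b c m : ℕ) (hm : 0 < m) (ham : a ∣ m) (hbm : b ∣ m) (hcm : c ∣ m)
    (u : B → Fin n → ℕ) (w : A → B → ℕ) (t : A → ℕ)
    (hu : ∀ β j, u β j ≤ m) (hw : ∀ α β, w α β ≤ m) (ht : ∀ α, t α ≤ m)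
    (f : (Fin n → Bool) → Bool)
    (hf : ∀ x, f x = decide (a ∣ ∑ α, t α * (decide (b ∣ ∑ β, w α β *
        (decide (c ∣ ∑ j, u β j * (x j).toNat)).toNat)).toNat)) (S : ℝ)
    (hS : ((Fintype.card B + Fintype.card B * (n * (m * m))) +
      (Fintype.card A + Fintype.card A * (Fintype.card B * (m * m))) +
      (1 + Fintype.card A * (m * m)) : ℕ) ≤ S) :
    HasModCircuit [m, m, m] f S ∧ HasModCircuit [a, b, c] f S := by
  obtain ⟨a', ha'⟩ := ham
  obtain ⟨b', hb'⟩ := hbm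
  obtain ⟨c', hc'⟩ := hcm
  have pa : 0 < a' := Nat.pos_of_ne_zero (by rintro rfl; omega)
  have pb : 0 < b' := Nat.pos_of_ne_zero (by rintro rfl; omega)
  have pc : 0 < c' := Nat.pos_of_ne_zero (by rintro rfl; omega)
  have la : a' ≤ m := Nat.le_of_dvd hm ⟨a, by rw [ha', mul_comm]⟩
  have lb : b' ≤ m := Nat.le_of_dvd hm ⟨b, by rw [hb', mul_comm]⟩
  have lc : c' ≤ m := Nat.le_of_dvd hm ⟨c, by rw [hc', mul_comm]⟩
  have lm : m ≤ m * m := Nat.le_mul_self m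
  constructor
  · refine ModCircuit.exists_three_layer m m m (m * m) (fun β j => c' * u β j)
      (fun α β => b' * w α β) (fun α => a' * t α) (fun β j => Nat.mul_le_mul lc (hu _ _))
      (fun α β => Nat.mul_le_mul lb (hw _ _)) (fun α => Nat.mul_le_mul la (ht _)) f
      (fun x => ?_) S hS
    rw [hf, modGate, ← (Fintype.equivFin A).symm.sum_comp]
    simp only [decide_eq_decide]
    have ec : ∀ β, (m ∣ ∑ j, c' * u β j * (x j).toNat) ↔ c ∣ ∑ j, u β j * (x j).toNat :=
      fun β => by rw [hc']; exact mul_dvd_sum_mul_iff _ pc _ _ _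
    simp only [ec]
    have eb : ∀ α, (m ∣ ∑ β, b' * w α β * (decide (c ∣ ∑ j, u β j * (x j).toNat)).toNat) ↔
        b ∣ ∑ β, w α β * (decide (c ∣ ∑ j, u β j * (x j).toNat)).toNat :=
      fun α => by rw [hb']; exact mul_dvd_sum_mul_iff _ pb _ _ _
    simp only [eb]
    rw [ha']
    exact (mul_dvd_sum_mul_iff _ pa _ _ _).symm
  · refine ModCircuit.exists_three_layer a b c (m * m) u w t (fun β j => (hu _ _).trans lm)
      (fun α β => (hw _ _).trans lm) (fun α => (ht _).trans lm) f (fun x => ?_) S hS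
    rw [hf, modGate, ← (Fintype.equivFin A).symm.sum_comp]

/-! ### Periodic functions as combinations of binomial coefficients -/

open fwdDiff in
-- Newton's forward difference formula. The inner binomials of `p ^ e` vanish modulo `p`, so the `p
-- ^ e`-th difference of `g` is `g (z + p ^ e) - g z = 0`, and the Newton series stops there.
theorem exists_choose_expansion {p : ℕ} (hp : p.Prime) (e : ℕ) (g : ℕ → ZMod p)
    (hg : ∀ z, g (z + p ^ e) = g z) :
    ∃ c : ℕ → ZMod p, ∀ z, g z = ∑ j ∈ Finset.range (p ^ e), c j * (z.choose j : ZMod p) := by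
  have hper : Δ_[1] ^[p ^ e] g = 0 := by
    funext y
    have hpos : 0 < p ^ e := pow_pos hp.pos e
    rw [fwdDiff_iter_eq_sum_shift, Finset.sum_range_succ, ← Finset.sum_range_add_sum_Ico _ hpos]
    have hmid : ∑ k ∈ Finset.Ico 1 (p ^ e),
        ((-1 : ℤ) ^ (p ^ e - k) * (p ^ e).choose k) • g (y + k • 1) = 0 := by
      refine Finset.sum_eq_zero fun k hk => ?_
      rw [Finset.mem_Ico] at hk
      have : ((p ^ e).choose k : ZMod p) = 0 :=
        (ZMod.natCast_eq_zero_iff _ _).2 (hp.dvd_choose_pow (by omega) (by omega))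
      simp [this]
    have hsign : ((-1 : ZMod p)) ^ p ^ e = -1 := by
      have := Fact.mk hp
      exact neg_one_pow_expChar_pow (ZMod p) p e
    rw [hmid]
    simp [hg, hsign]
  have hzero : ∀ k, p ^ e ≤ k → Δ_[1] ^[k] g = 0 := by
    intro k hk
    obtain ⟨i, rfl⟩ := Nat.exists_eq_add_of_le' hk
    rw [Function.iterate_add_apply, hper]
    induction i with
    | zero => rfl
    | succ i ih =>
      rw [Function.iterate_succ_apply', ih (Nat.le_add_left _ _)]
      funext y
      simp [fwdDiff]
  refine ⟨fun j => Δ_[1] ^[j] g 0, fun z => ?_⟩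
  have h := shift_eq_sum_fwdDiff_iter 1 g z 0
  simp only [smul_eq_mul, mul_one, zero_add, nsmul_eq_mul] at h
  -- The range is long enough to be cut at either end: past `z` the binomials vanish, past `p ^ e`
  -- the differences do.
  have h' : g z = ∑ k ∈ Finset.range (z + 1 + p ^ e), Δ_[1] ^[k] g 0 * (z.choose k : ZMod p) := by
    rw [Finset.sum_range_add, h, Finset.sum_eq_zero (s := Finset.range (p ^ e)), add_zero]
    · exact Finset.sum_congr rfl fun k _ => mul_comm _ _
    · intro k _
      rw [Nat.choose_eq_zero_of_lt (by omega)]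
      simp
  rw [h', add_comm (z + 1), Finset.sum_range_add, Finset.sum_eq_zero (s := Finset.range (z + 1)),
    add_zero]
  intro k _
  rw [hzero _ (Nat.le_add_right _ _)]
  simp

/-! ### Detecting the zero vector modulo 2 -/

/-- By finiteness the powers of `y` are eventually periodic, so a power whose exponent is a large
multiple of the period is idempotent. It is nonzero because the ring is reduced. -/
theorem exists_isIdempotentElem_mul {R : Type*} [CommRing R] [Finite R] [IsReduced R] {y : R}
    (hy : y ≠ 0) : ∃ a, IsIdempotentElem (a * y) ∧ a * y ≠ 0 := by
  obtain ⟨i, j, hij, h⟩ := Finite.exists_ne_map_eq_of_infinite (fun k : ℕ => y ^ (k + 1))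
  wlog hlt : i < j generalizing i j
  · exact this j i hij.symm h.symm (by omega)
  obtain ⟨k, rfl⟩ := Nat.exists_eq_add_of_lt hlt
  have hstep : ∀ s, y ^ (i + 1 + s * (k + 1)) = y ^ (i + 1) := by
    intro s
    induction s with
    | zero => simp
    | succ s ih =>
      rw [show i + 1 + (s + 1) * (k + 1) = (i + 1 + s * (k + 1)) + (k + 1) by ring, pow_add, ih,
        ← pow_add, h]
      congr 1; ring
  have hmul : ∀ s t, i + 1 ≤ t → y ^ (t + s * (k + 1)) = y ^ t := by
    intro s t ht
    obtain ⟨t, rfl⟩ := Nat.exists_eq_add_of_le ht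
    rw [show i + 1 + t + s * (k + 1) = (i + 1 + s * (k + 1)) + t by ring, pow_add, hstep, ← pow_add]
  refine ⟨y ^ (i * (k + 1) + k), ?_, ?_⟩
  · have hle : i + 1 ≤ (i + 1) * (k + 1) := Nat.le_mul_of_pos_right _ (by omega)
    have := hmul (i + 1) ((i + 1) * (k + 1)) hle
    rw [IsIdempotentElem, ← pow_succ, ← pow_add]
    convert this using 2 <;> ring
  · rw [← pow_succ]
    exact pow_ne_zero _ hy

/-- Over a finite reduced ring of odd cardinality, the number of linear forms whose value at `y`
is idempotent is odd exactly when `y = 0`. -/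
theorem sum_isIdempotentElem_dotProduct {R K : Type*} [CommRing R] [Fintype R] [DecidableEq R]
    [IsReduced R] [Fintype K] [DecidableEq K] (hodd : Odd (Fintype.card R)) (y : K → R) :
    ∑ l : K → R, (if (∑ k, l k * y k) * (∑ k, l k * y k) = ∑ k, l k * y k then 1 else 0 : ZMod 2)
      = if ∀ k, y k = 0 then 1 else 0 := by
  split_ifs with hy
  · simp only [hy, mul_zero, Finset.sum_const_zero, if_true, Finset.sum_const, Finset.card_univ,
      Fintype.card_fun, nsmul_eq_mul, mul_one]
    rw [ZMod.natCast_eq_one_iff_odd]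
    exact hodd.pow
  · push Not at hy
    obtain ⟨k₀, hk₀⟩ := hy
    obtain ⟨a, hid, hne⟩ := exists_isIdempotentElem_mul hk₀
    set e := a * y k₀ with he
    have hid' : e * e = e := hid
    let v (l : K → R) : R := ∑ k, l k * y k
    -- For `y ≠ 0` the forms with idempotent value cancel in pairs. The shift `T` replaces the value
    -- `v` by `1 - v` on the component of the idempotent `e` and keeps it on that of `1 - e`, so `v
    -- * v - v` does not change.
    let T (l : K → R) : K → R := fun k => l k + (Pi.single k₀ (e * a * (1 - 2 * v l)) : K → R) k
    have hv : ∀ l, v (T l) = v l + e - 2 * e * v l := by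
      intro l
      simp only [v, T, add_mul, Finset.sum_add_distrib]
      rw [Finset.sum_eq_single (f := fun k => (Pi.single k₀ (e * a * (1 - 2 * ∑ k, l k * y k)) : K → R) k * y k) k₀]
      · rw [Pi.single_eq_same]
        linear_combination (1 - 2 * (∑ k, l k * y k)) * hid' -
          (1 - 2 * (∑ k, l k * y k)) * e * he
      · intro k _ hk
        simp [hk]
      · simp
    refine Finset.sum_involution (fun l _ => T l) ?_ ?_ (fun _ _ => Finset.mem_univ _) ?_
    · intro l _
      have : v (T l) * v (T l) = v (T l) ↔ v l * v l = v l := by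
        rw [hv]
        have key : (v l + e - 2 * e * v l) * (v l + e - 2 * e * v l) -
            (v l + e - 2 * e * v l) = v l * v l - v l := by
          linear_combination (1 - 4 * v l + 4 * v l * v l) * hid'
        rw [← sub_eq_zero, key, sub_eq_zero]
      change (if v l * v l = v l then 1 else 0 : ZMod 2) +
        (if v (T l) * v (T l) = v (T l) then 1 else 0) = 0
      simp only [this]
      exact CharTwo.add_self_eq_zero _
    -- A fixed form would satisfy `e * (1 - 2 * v) = 0`. Since `v` is idempotent, `(1 - 2 * v) ^ 2 =
    -- 1`, which forces `e = 0`.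
    · intro l _ hl hT
      have hl' : v l * v l = v l := by
        by_contra hcon
        exact hl (if_neg hcon)
      have h := hv l
      rw [hT] at h
      apply hne
      linear_combination (-(1 - 2 * v l)) * h - 4 * e * hl'
    · intro l _
      funext k
      change l k + (Pi.single k₀ (e * a * (1 - 2 * v l)) : K → R) k +
        (Pi.single k₀ (e * a * (1 - 2 * v (T l))) : K → R) k = l k
      rw [hv, add_assoc, ← Pi.add_apply, ← Pi.single_add]
      rw [show e * a * (1 - 2 * v l) + e * a * (1 - 2 * (v l + e - 2 * e * v l)) = 0 by
        linear_combination (-2 * a + 4 * a * v l) * hid']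
      simp

/-! ### Combinations of parities -/

/-- The indicator that `x` has an even number of ones in `S`. -/
def parityInd (R : Type*) [Zero R] [One R] {n : ℕ} (S : Finset (Fin n)) (x : Fin n → Bool) : R :=
  if 2 ∣ ∑ j ∈ S, (x j).toNat then 1 else 0

/-- The indicator that `x` has no ones in `S`. -/
def norInd (R : Type*) [Zero R] [One R] {n : ℕ} (S : Finset (Fin n)) (x : Fin n → Bool) : R :=
  if ∀ j ∈ S, x j = false then 1 else 0

/-- The number of zeros of a Boolean vector. -/
def numZeros {n : ℕ} (x : Fin n → Bool) : ℕ := (Finset.univ.filter fun j => x j = false).card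

theorem numZeros_add_hammingWeight {n : ℕ} (x : Fin n → Bool) :
    numZeros x + hammingWeight x = n := by
  rw [numZeros, hammingWeight, Finset.card_filter, ← Finset.sum_add_distrib]
  rw [Finset.sum_congr rfl (g := fun _ => 1) fun j _ => by cases x j <;> rfl]
  simp

/-- The functions that are combinations of the parities of at most `d` inputs. -/
def paritySpan (R : Type*) [CommRing R] (n d : ℕ) : Submodule R ((Fin n → Bool) → R) :=
  Submodule.span R (Set.range fun S : {S : Finset (Fin n) // S.card ≤ d} => parityInd R S.1)

section Span

variable {R : Type*} [CommRing R] {n d : ℕ}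

theorem parityInd_mem_paritySpan {S : Finset (Fin n)} (hS : S.card ≤ d) :
    parityInd R S ∈ paritySpan R n d :=
  Submodule.subset_span ⟨⟨S, hS⟩, rfl⟩

theorem parityInd_empty : parityInd R (∅ : Finset (Fin n)) = fun _ => 1 := by
  funext x
  simp [parityInd]

theorem const_mem_paritySpan (r : R) : (fun _ => r) ∈ paritySpan R n d := by
  have h := (paritySpan R n d).smul_mem r (parityInd_mem_paritySpan (S := ∅) (by simp))
  rw [parityInd_empty] at h
  convert h using 1
  funext x
  simp

theorem toNat_mem_paritySpan (hd : 1 ≤ d) (j : Fin n) :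
    (fun x : Fin n → Bool => ((x j).toNat : R)) ∈ paritySpan R n d := by
  have h := (paritySpan R n d).sub_mem (const_mem_paritySpan 1)
    (parityInd_mem_paritySpan (S := {j}) (by simpa using hd))
  convert h using 1
  funext x
  cases hx : x j <;> simp [parityInd, hx]

theorem prod_one_add_neg_one_pow (S : Finset (Fin n)) (x : Fin n → Bool) :
    ∏ j ∈ S, (1 + (-1 : R) ^ (x j).toNat) = 2 ^ S.card * norInd R S x := by
  rw [norInd]
  split_ifs with h
  · rw [Finset.prod_congr rfl (g := fun _ => (2 : R)) fun j hj => by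
      rw [h j hj]; norm_num]
    simp
  · push Not at h
    obtain ⟨j, hj, hx⟩ := h
    rw [Finset.prod_eq_zero hj (by simp [hx]), mul_zero]

theorem neg_one_pow_sum_eq (S : Finset (Fin n)) (x : Fin n → Bool) :
    (-1 : R) ^ ∑ j ∈ S, (x j).toNat = 2 * parityInd R S x - 1 := by
  rw [parityInd]
  split_ifs with h
  · rw [Even.neg_one_pow (even_iff_two_dvd.2 h)]; ring
  · rw [Odd.neg_one_pow (Nat.not_even_iff_odd.1 fun h' => h (even_iff_two_dvd.1 h'))]; ring

/-- The product of the factors `1 + (-1) ^ x j` over `S` is `2 ^ S.card` times the NOR. Expanded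
over subsets it is a sum of signs, each of the form `2 * parity - 1`, and the power of 2 can be
divided out. -/
theorem norInd_mem_paritySpan (h2 : IsUnit (2 : R)) {S : Finset (Fin n)} (hS : S.card ≤ d) :
    norInd R S ∈ paritySpan R n d := by
  obtain ⟨u, hu⟩ := h2.pow S.card
  have h : (fun x : Fin n → Bool => (2 : R) ^ S.card * norInd R S x) ∈ paritySpan R n d := by
    have : (fun x : Fin n → Bool => (2 : R) ^ S.card * norInd R S x) =
        ∑ T ∈ S.powerset, ((2 : R) • parityInd R T - fun _ => 1) := by
      funext x
      rw [← prod_one_add_neg_one_pow, Finset.prod_one_add, Finset.sum_apply]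
      refine Finset.sum_congr rfl fun T _ => ?_
      rw [Finset.prod_pow_eq_pow_sum, neg_one_pow_sum_eq]
      simp
    rw [this]
    refine Submodule.sum_mem _ fun T hT => Submodule.sub_mem _ (Submodule.smul_mem _ _
      (parityInd_mem_paritySpan ?_)) (const_mem_paritySpan 1)
    exact (Finset.card_le_card (Finset.mem_powerset.1 hT)).trans hS
  have h' := (paritySpan R n d).smul_mem (↑u⁻¹ : R) h
  convert h' using 1
  funext x
  simp only [Pi.smul_apply, smul_eq_mul, ← hu, Units.inv_mul_cancel_left]

/-- Both sides count the `j`-sets of positions contained in the zero set of `x`. -/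
theorem choose_numZeros (j : ℕ) (x : Fin n → Bool) :
    ((numZeros x).choose j : R) = ∑ S ∈ Finset.powersetCard j Finset.univ, norInd R S x := by
  simp only [norInd]
  rw [Finset.sum_boole, numZeros, ← Finset.card_powersetCard]
  congr 2
  ext S
  simp only [Finset.mem_powersetCard, Finset.mem_filter, true_and, Finset.subset_iff,
    Finset.mem_univ]
  tauto

theorem choose_numZeros_mem_paritySpan (h2 : IsUnit (2 : R)) {j : ℕ} (hj : j ≤ d) :
    (fun x : Fin n → Bool => ((numZeros x).choose j : R)) ∈ paritySpan R n d := by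
  have : (fun x : Fin n → Bool => ((numZeros x).choose j : R)) =
      ∑ S ∈ Finset.powersetCard j Finset.univ, norInd R S := by
    funext x
    rw [choose_numZeros, Finset.sum_apply]
  rw [this]
  exact Submodule.sum_mem _ fun S hS => norInd_mem_paritySpan h2
    ((Finset.mem_powersetCard.1 hS).2.trans_le hj)

end Span

/-- For a prime power `p ^ e ≤ d` and `M = p * N`, the multiple `N • [z ≢ v mod p ^ e]` of the
indicator of a congruence for the number `z` of zeros is, modulo `M`, a combination of parities of
at most `d` inputs. -/
theorem mul_ite_modEq_mem_paritySpan {n d p N M e : ℕ} (hM : M = p * N) (hp : p.Prime)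
    (h2 : IsUnit (2 : ZMod M)) (hd : p ^ e ≤ d) (v : ℕ) :
    (fun x : Fin n → Bool => (N : ZMod M) * if numZeros x ≡ v [MOD p ^ e] then 0 else 1) ∈
      paritySpan (ZMod M) n d := by
  subst hM
  obtain ⟨c, hc⟩ := exists_choose_expansion hp e
    (fun z => if z ≡ v [MOD p ^ e] then 0 else 1) (fun z => if_congr (by simp [Nat.ModEq]) rfl rfl)
  -- Multiplication by `N` carries congruences modulo `p` to congruences modulo `p * N`, so the
  -- expansion over `ZMod p` can be used over `ZMod M`.
  have hN : ∀ a b : ℕ, (a : ZMod p) = b →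
      (N : ZMod (p * N)) * (a : ZMod (p * N)) = (N : ZMod (p * N)) * b := by
    intro a b h
    rw [ZMod.natCast_eq_natCast_iff] at h
    rw [← Nat.cast_mul, ← Nat.cast_mul, ZMod.natCast_eq_natCast_iff, mul_comm p N]
    exact h.mul_left' N
  have : (fun x : Fin n → Bool =>
      (N : ZMod (p * N)) * if numZeros x ≡ v [MOD p ^ e] then 0 else 1) =
      ∑ j ∈ Finset.range (p ^ e), ((N * (c j).val : ℕ) : ZMod (p * N)) •
        fun x : Fin n → Bool => ((numZeros x).choose j : ZMod (p * N)) := by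
    funext x
    have := NeZero.mk hp.ne_zero
    have h := hN (if numZeros x ≡ v [MOD p ^ e] then 0 else 1)
      (∑ j ∈ Finset.range (p ^ e), (c j).val * (numZeros x).choose j) (by
        push_cast
        simp only [ZMod.natCast_zmod_val]
        exact hc (numZeros x))
    push_cast at h
    rw [h, Finset.sum_apply, Finset.mul_sum]
    refine Finset.sum_congr rfl fun j _ => ?_
    simp [mul_assoc]
  rw [this]
  refine Submodule.sum_mem _ fun j hj => Submodule.smul_mem _ _ ?_
  exact choose_numZeros_mem_paritySpan h2 ((Finset.mem_range.1 hj).le.trans hd)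

/-- The indicator of a congruence modulo `2 ^ e` for the number of zeros is, modulo `2`, a
combination of NORs of at most `d` inputs. -/
theorem exists_ite_modEq_eq_sum_norInd {n d e : ℕ} (hd : 2 ^ e ≤ d) (v : ℕ) :
    ∃ c : {S : Finset (Fin n) // S.card ≤ d} → ZMod 2, ∀ x : Fin n → Bool,
      (if numZeros x ≡ v [MOD 2 ^ e] then 1 else 0) = ∑ S, c S * norInd (ZMod 2) S.1 x := by
  obtain ⟨c, hc⟩ := exists_choose_expansion Nat.prime_two e
    (fun z => if z ≡ v [MOD 2 ^ e] then 1 else 0) (fun z => if_congr (by simp [Nat.ModEq]) rfl rfl)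
  -- All sets of one size `j` share the coefficient of `z.choose j`. Sizes from `2 ^ e` up to `d` do
  -- not occur in the expansion and get 0.
  refine ⟨fun S => if S.1.card < 2 ^ e then c S.1.card else 0, fun x => ?_⟩
  refine (hc (numZeros x)).trans ?_
  rw [← Finset.sum_subtype (Finset.univ.filter fun S : Finset (Fin n) => S.card ≤ d) (by simp)
    (fun S => (if S.card < 2 ^ e then c S.card else 0) * norInd (ZMod 2) S x)]
  simp only [ite_mul, zero_mul]
  rw [← Finset.sum_filter, ← Finset.sum_fiberwise_of_maps_to (g := Finset.card)
    (t := Finset.range (2 ^ e)) (by simp)]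
  refine Finset.sum_congr rfl fun j hj => ?_
  rw [Finset.mem_range] at hj
  rw [choose_numZeros, Finset.mul_sum]
  refine Finset.sum_congr ?_ ?_
  · ext S
    simp only [Finset.mem_powersetCard, Finset.subset_univ, true_and, Finset.mem_filter,
      Finset.mem_univ]
    omega
  · intro S hS
    simp only [Finset.mem_filter] at hS
    rw [hS.2]

/-! ### The product of the first primes -/

theorem lcmUpto_le_pow_primeCounting {n : ℕ} (hn : 1 ≤ n) :
    Nat.lcmUpto n ≤ n ^ Nat.primeCounting n := by
  rw [Nat.lcmUpto_eq_prod_pow_log, ← Nat.primesLE_card_eq_primeCounting]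
  exact Finset.prod_le_pow_card _ _ _ fun p _ => Nat.pow_log_le_self p (by omega)

/-- With `N = 4 * k ^ 2`, Chebyshev's bound gives `2 ^ N ≤ (N + 1) * N ^ π(N)`. If `π(N) ≤ k`, then
`N + 1 ≤ 16 ^ (k - 1)` would give `16 ^ (k ^ 2) ≤ 16 ^ (k ^ 2 - 1)`. -/
theorem lt_primeCounting_four_mul_sq {k : ℕ} (hk : 4 ≤ k) :
    k < Nat.primeCounting (4 * k ^ 2) := by
  by_contra! hcon
  have h1 := Chebyshev.two_pow_le_mul_lcmUpto (4 * k ^ 2)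
  have h2 := lcmUpto_le_pow_primeCounting (n := 4 * k ^ 2) (by nlinarith)
  have h3 : 4 * k ^ 2 + 1 ≤ 16 ^ (k - 1) := by
    obtain ⟨j, rfl⟩ := Nat.exists_eq_add_of_le hk
    clear hk hcon h1 h2
    induction j with
    | zero => norm_num
    | succ j ih =>
      rw [show 4 + (j + 1) - 1 = (4 + j - 1) + 1 by omega, pow_succ 16]
      nlinarith
  have h4 : 2 ^ (4 * k ^ 2) ≤ 16 ^ ((k - 1) * (k + 1)) :=
    calc 2 ^ (4 * k ^ 2) ≤ (4 * k ^ 2 + 1) * (4 * k ^ 2) ^ k :=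
          h1.trans (Nat.mul_le_mul_left _ (h2.trans (Nat.pow_le_pow_right (by nlinarith) hcon)))
      _ ≤ (4 * k ^ 2 + 1) * (4 * k ^ 2 + 1) ^ k := by gcongr; omega
      _ = (4 * k ^ 2 + 1) ^ (k + 1) := by ring
      _ ≤ (16 ^ (k - 1)) ^ (k + 1) := by gcongr
      _ = _ := by rw [pow_mul]
  rw [pow_mul, show 2 ^ 4 = 16 by norm_num] at h4
  have h5 := (Nat.pow_le_pow_iff_right (by norm_num : 1 < 16)).1 h4
  obtain ⟨j, rfl⟩ := Nat.exists_eq_add_of_le hk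
  rw [show 4 + j - 1 = 3 + j by omega] at h5
  nlinarith

theorem nth_prime_le_four_mul_sq {k : ℕ} (hk : 4 ≤ k) : Nat.nth Nat.Prime k ≤ 4 * k ^ 2 :=
  Nat.le_of_lt_succ (Nat.nth_lt_of_lt_count (lt_primeCounting_four_mul_sq hk))

theorem two_mul_pow_self_le (n : ℕ) (hn : 1 ≤ n) : 2 * n ^ n ≤ (n + 1) ^ n := by
  -- Bernoulli's inequality `1 + j / n ≤ (1 + 1 / n) ^ j` with denominators cleared; the case `j =
  -- n` is the claim.
  have h : ∀ j, n ^ j * (n + j) ≤ n * (n + 1) ^ j := by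
    intro j
    induction j with
    | zero => simp
    | succ j ih =>
      calc n ^ (j + 1) * (n + (j + 1)) ≤ n ^ j * (n + j) * (n + 1) := by
            rw [pow_succ, mul_assoc, mul_assoc]
            exact Nat.mul_le_mul_left _ (by nlinarith)
        _ ≤ n * (n + 1) ^ j * (n + 1) := by gcongr
        _ = _ := by ring
  have := h n
  exact Nat.le_of_mul_le_mul_left (by linarith : n * (2 * n ^ n) ≤ n * (n + 1) ^ n) hn

theorem prod_nth_prime_le {N : ℕ} (hN : 3 ≤ N) :
    ∏ i ∈ Finset.range (N + 1), Nat.nth Nat.Prime i ≤ N ^ (2 * N) := by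
  induction N, hN using Nat.le_induction with
  | base =>
    simp [Finset.prod_range_succ]
  | succ N hN ih =>
    rw [Finset.prod_range_succ]
    have h := two_mul_pow_self_le N (by omega)
    calc _ ≤ N ^ (2 * N) * (4 * (N + 1) ^ 2) :=
          Nat.mul_le_mul ih (nth_prime_le_four_mul_sq (by omega))
      _ = (2 * N ^ N) ^ 2 * (N + 1) ^ 2 := by ring
      _ ≤ ((N + 1) ^ N) ^ 2 * (N + 1) ^ 2 := by gcongr
      _ = _ := by ring

/-- For every `ε > 0` there is a number `r + 1 > 1 / ε` of primes such that the product of the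
first `r + 1` primes is at most the stated bound. -/
theorem exists_prod_nth_prime_le {ε : ℝ} (hε : 0 < ε) :
    ∃ r : ℕ, 1 ≤ r ∧ 1 < ε * (r + 1) ∧
      (ε ≤ 1 / 2 → ((∏ i : Fin (r + 1), Nat.nth Nat.Prime i : ℕ) : ℝ) ≤
        max 30 ((1 / ε) ^ (2 / ε))) ∧
      (1 / 2 < ε → ((∏ i : Fin (r + 1), Nat.nth Nat.Prime i : ℕ) : ℝ) ≤
        max 6 ((1 / ε) ^ (2 / ε))) := by
  simp only [← Finset.prod_range (fun i => Nat.nth Nat.Prime i)]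
  rcases lt_or_ge (1 / 2) ε with h | h
  · refine ⟨1, le_rfl, by push_cast; linarith, fun h' => absurd h h'.not_gt, fun _ => ?_⟩
    refine le_max_of_le_left ?_
    norm_num [Finset.prod_range_succ]
  have hfl : 1 < ε * (⌊1 / ε⌋₊ + 1) := by
    have := Nat.lt_floor_add_one (1 / ε)
    rw [div_lt_iff₀ hε] at this
    linarith
  have h2 : 2 ≤ ⌊1 / ε⌋₊ := by
    refine Nat.le_floor ?_
    rw [le_div_iff₀ hε]
    push_cast
    linarith
  -- The value 2 of the floor is the exceptional case `2 * 3 * 5 = 30`; from 3 on, the product is at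
  -- most `N ^ (2 * N)` with `N = ⌊1 / ε⌋₊`.
  refine ⟨⌊1 / ε⌋₊, by omega, hfl, fun _ => ?_, fun h' => absurd h h'.not_ge⟩
  rcases h2.eq_or_lt with h2 | h3
  · rw [← h2]
    refine le_max_of_le_left ?_
    norm_num [Finset.prod_range_succ]
  · refine le_max_of_le_right ?_
    have hle : (⌊1 / ε⌋₊ : ℝ) ≤ 1 / ε := Nat.floor_le (by positivity)
    have h3' : (3 : ℝ) ≤ (⌊1 / ε⌋₊ : ℝ) := by exact_mod_cast h3
    calc ((∏ i ∈ Finset.range (⌊1 / ε⌋₊ + 1), Nat.nth Nat.Prime i : ℕ) : ℝ)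
        ≤ ((⌊1 / ε⌋₊ ^ (2 * ⌊1 / ε⌋₊) : ℕ) : ℝ) := by exact_mod_cast prod_nth_prime_le h3
      _ = (⌊1 / ε⌋₊ : ℝ) ^ ((2 * ⌊1 / ε⌋₊ : ℕ) : ℝ) := by
          rw [Real.rpow_natCast]; push_cast; rfl
      _ ≤ (1 / ε) ^ ((2 * ⌊1 / ε⌋₊ : ℕ) : ℝ) :=
          Real.rpow_le_rpow (by positivity) hle (by positivity)
      _ ≤ (1 / ε) ^ (2 / ε) := by
          refine Real.rpow_le_rpow_of_exponent_le (by linarith) ?_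
          push_cast
          rw [show 2 / ε = 2 * (1 / ε) by ring]
          linarith

/-! ### ### The weights of the middle and output layers -/

/-- The gates of the bottom layer: the parities of at most `d` inputs. -/
abbrev BottomIndex (n d : ℕ) := {S : Finset (Fin n) // S.card ≤ d}

/-- The gates of the middle layer: a weight `v`, a set `S` of at most `d` inputs, a linear form
in the variables of `S` and `r` further ones, and a constant term. -/
abbrev MiddleIndex (n d r M : ℕ) :=
  Fin (n + 1) × (Σ S : BottomIndex n d, (S.1 ⊕ Fin r → ZMod M)) × ZMod M

theorem eq_of_forall_modEq {ι : Type*} [Fintype ι] {p e : ι → ℕ} (hp : ∀ i, (p i).Prime)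
    (hinj : Function.Injective p) {n a b : ℕ} (hn : n < ∏ i, p i ^ e i) (ha : a ≤ n) (hb : b ≤ n)
    (h : ∀ i, a ≡ b [MOD p i ^ e i]) : a = b := by
  have hdvd : ((∏ i, p i ^ e i : ℕ) : ℤ) ∣ (b : ℤ) - a := by
    push_cast
    refine Finset.prod_dvd_of_coprime (fun i _ j _ hij => ?_) fun i _ => ?_
    · have := Nat.isCoprime_iff_coprime.2
        (((Nat.coprime_primes (hp i) (hp j)).2 (hinj.ne hij)).pow (e i) (e j))
      simpa [Function.onFun] using this
    · exact_mod_cast (Nat.modEq_iff_dvd.1 (h i))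
  exact Nat.ModEq.eq_of_lt_of_lt (Nat.modEq_iff_dvd.2 hdvd) (by omega) (by omega)

theorem squarefree_prod_of_injective {ι : Type*} [Fintype ι] {p : ι → ℕ}
    (hp : ∀ i, (p i).Prime) (hinj : Function.Injective p) : Squarefree (∏ i, p i) := by
  refine Finset.squarefree_prod_of_pairwise_isCoprime (fun i _ j _ hij => ?_)
    fun i _ => (hp i).squarefree
  simp only [Function.onFun]
  exact Nat.coprime_iff_isRelPrime.1 ((Nat.coprime_primes (hp i) (hp j)).2 (hinj.ne hij))

/-- The sum over linear forms `l` and idempotents `a` detects, modulo 2, that `x` vanishes on `S`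
and that `z ≡ v` modulo all odd prime powers. Summing over `S` with the NOR coefficients adds the
condition modulo `2 ^ e 0`, which leaves `z = v` by the Chinese remainder theorem. -/
theorem exists_middle_weights {n d r : ℕ} (hr : 1 ≤ r) {p : Fin (r + 1) → ℕ}
    (hp : ∀ i, (p i).Prime) (hinj : Function.Injective p) (h0 : p 0 = 2) (e : Fin (r + 1) → ℕ)
    (hd : ∀ i, p i ^ e i ≤ d) (hn : n < ∏ i, p i ^ e i) {M : ℕ} [NeZero M]
    (hM : M = ∏ i : Fin r, p i.succ) (g : ℕ → Bool) :
    ∃ (w : MiddleIndex n d r M → BottomIndex n d → ZMod M) (t : MiddleIndex n d r M → ZMod 2),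
      ∀ x : Fin n → Bool,
        ∑ α, t α * (if ∑ β, w α β * parityInd (ZMod M) β.1 x = 0 then 1 else 0) =
          if g (numZeros x) then 0 else 1 := by
  classical
  have hodd : Odd M := by
    rw [hM]
    refine Finset.prod_induction _ Odd (fun _ _ => Odd.mul) odd_one fun i _ => ?_
    refine (hp _).odd_of_ne_two fun h => ?_
    exact Fin.succ_ne_zero i (hinj (h.trans h0.symm))
  have h2 : IsUnit (2 : ZMod M) := by
    exact_mod_cast (ZMod.isUnit_iff_coprime 2 M).2 (Nat.coprime_two_left.2 hodd)
  have : IsReduced (ZMod M) := isReduced_zmod.2 (Or.inl (hM ▸ squarefree_prod_of_injective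
    (fun i => hp _) (hinj.comp (Fin.succ_injective r))))
  -- `N i` is `M / p i.succ`. It is nonzero modulo `M`, and it places a quantity known only modulo
  -- `p i.succ` inside `ZMod M`.
  let N (i : Fin r) : ℕ := ∏ j ∈ Finset.univ.erase i, p j.succ
  have hMN : ∀ i, M = p i.succ * N i := fun i => by
    rw [hM]; exact (Finset.mul_prod_erase _ _ (Finset.mem_univ i)).symm
  have hN0 : ∀ i, (N i : ZMod M) ≠ 0 := by
    intro i h
    have hpos : 0 < N i := Finset.prod_pos fun j _ => (hp _).pos
    have hle := Nat.le_of_dvd hpos ((ZMod.natCast_eq_zero_iff _ _).1 h)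
    rw [hMN i] at hle
    nlinarith [(hp i.succ).two_le]
  have hM1 : 1 < M := by
    have i : Fin r := ⟨0, hr⟩
    have hpos : 0 < N i := Finset.prod_pos fun j _ => (hp _).pos
    rw [hMN i]
    nlinarith [(hp i.succ).two_le]
  have : Fact (1 < M) := ⟨hM1⟩
  have hd1 : 1 ≤ d := (Nat.one_le_pow _ _ (hp 0).pos).trans (hd 0)
  let y (v : ℕ) (S : Finset (Fin n)) (k : S ⊕ Fin r) (x : Fin n → Bool) : ZMod M :=
    Sum.elim (α := S) (fun j => ((x j).toNat : ZMod M))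
      (fun i => N i * if numZeros x ≡ v [MOD p i.succ ^ e i.succ] then 0 else 1) k
  have hy : ∀ v S k, y v S k ∈ paritySpan (ZMod M) n d := by
    rintro v S (j | i)
    · exact toNat_mem_paritySpan hd1 j.1
    · exact mul_ite_modEq_mem_paritySpan (hMN i) (hp _) h2 (hd _) v
  have hy0 : ∀ v S x, (∀ k, y v S k x = 0) ↔
      (∀ j ∈ S, x j = false) ∧ ∀ i : Fin r, numZeros x ≡ v [MOD p i.succ ^ e i.succ] := by
    intro v S x
    rw [Sum.forall]
    refine and_congr ⟨fun h j hj => ?_, fun h j => ?_⟩ (forall_congr' fun i => ?_)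
    · have := h ⟨j, hj⟩
      cases hx : x j
      · rfl
      · simp [y, hx] at this
    · simp [y, h j.1 j.2]
    · by_cases hv : numZeros x ≡ v [MOD p i.succ ^ e i.succ] <;> simp [y, hv, hN0]
  have hform : ∀ α : MiddleIndex n d r M, ∃ w : BottomIndex n d → ZMod M, ∀ x : Fin n → Bool,
      ∑ β, w β * parityInd (ZMod M) β.1 x =
        ∑ k, α.2.1.2 k * y α.1 α.2.1.1.1 k x - α.2.2 := by
    intro α
    have hmem : (fun x => ∑ k, α.2.1.2 k * y α.1 α.2.1.1.1 k x - α.2.2) ∈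
        paritySpan (ZMod M) n d := by
      have := (paritySpan (ZMod M) n d).sub_mem
        (Submodule.sum_mem _ fun k (_ : k ∈ Finset.univ) => Submodule.smul_mem _ (α.2.1.2 k)
          (hy α.1 α.2.1.1.1 k)) (const_mem_paritySpan α.2.2)
      convert this using 1
      funext x
      simp
    obtain ⟨w, hw⟩ := (Submodule.mem_span_range_iff_exists_fun _).1 hmem
    exact ⟨w, fun x => by simpa using congrFun hw x⟩
  choose w hw using hform
  choose c hc using fun v => exists_ite_modEq_eq_sum_norInd (n := n) (d := d) (e := e 0)
    (h0 ▸ hd 0) v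
  -- The values `v` with `g v` false are the ones summed, because a `MOD` gate outputs 1 when its
  -- sum vanishes.
  refine ⟨w, fun α => (if g α.1 then 0 else 1) * c α.1 α.2.1.1 *
    (if α.2.2 * α.2.2 = α.2.2 then 1 else 0), fun x => ?_⟩
  -- Idempotency of a value is not a single gate, but it is the sum of the tests `z = a` over the
  -- idempotents `a`, at most one of which succeeds.
  have hidem : ∀ z : ZMod M, ∑ a : ZMod M, (if a * a = a then 1 else 0 : ZMod 2) *
      (if z - a = 0 then 1 else 0) = if z * z = z then 1 else 0 := by
    intro z
    rw [Finset.sum_eq_single z] <;> simp +contextual [sub_eq_zero, eq_comm]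
  have hcount : ∀ v (S : BottomIndex n d), ∑ l : S.1 ⊕ Fin r → ZMod M, ∑ a : ZMod M,
      (if a * a = a then 1 else 0 : ZMod 2) *
        (if ∑ k, l k * y v S.1 k x - a = 0 then 1 else 0) =
      norInd (ZMod 2) S.1 x *
        if ∀ i : Fin r, numZeros x ≡ v [MOD p i.succ ^ e i.succ] then 1 else 0 := by
    intro v S
    simp only [hidem]
    rw [sum_isIdempotentElem_dotProduct (by rwa [ZMod.card]) fun k => y v S.1 k x]
    simp only [hy0, norInd, ite_and]
    split_ifs <;> simp
  have hz : numZeros x ≤ n := by have := numZeros_add_hammingWeight x; omega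
  have hv : ∀ v : Fin (n + 1), (∑ S : BottomIndex n d, c v S * (norInd (ZMod 2) S.1 x *
      if ∀ i : Fin r, numZeros x ≡ v [MOD p i.succ ^ e i.succ] then 1 else 0)) =
      if numZeros x = v then 1 else 0 := by
    intro v
    simp only [← mul_assoc]
    rw [← Finset.sum_mul, ← hc]
    have : numZeros x = v ↔ numZeros x ≡ v [MOD 2 ^ e 0] ∧
        ∀ i : Fin r, numZeros x ≡ v [MOD p i.succ ^ e i.succ] := by
      refine ⟨fun h => by simp [h, Nat.ModEq.refl], fun h => ?_⟩
      refine eq_of_forall_modEq hp hinj hn hz (by omega) fun i => ?_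
      refine Fin.cases ?_ h.2 i
      rw [h0]; exact h.1
    simp only [this, ite_and]
    split_ifs <;> simp
  calc _ = ∑ v : Fin (n + 1), (if g v then 0 else 1) * ∑ S : BottomIndex n d, c v S *
        ∑ l : S.1 ⊕ Fin r → ZMod M, ∑ a : ZMod M, (if a * a = a then 1 else 0 : ZMod 2) *
          (if ∑ k, l k * y v S.1 k x - a = 0 then 1 else 0) := by
        rw [Fintype.sum_prod_type]
        refine Finset.sum_congr rfl fun v _ => ?_
        rw [Fintype.sum_prod_type, Fintype.sum_sigma, Finset.mul_sum]
        refine Finset.sum_congr rfl fun S _ => ?_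
        rw [Finset.mul_sum, Finset.mul_sum]
        refine Finset.sum_congr rfl fun l _ => ?_
        rw [Finset.mul_sum, Finset.mul_sum]
        refine Finset.sum_congr rfl fun a _ => ?_
        simp only [hw, mul_assoc]
    _ = ∑ v : Fin (n + 1), (if g v then 0 else 1) * if numZeros x = v then 1 else 0 := by
        simp only [hcount, hv]
    _ = _ := by
        rw [Finset.sum_eq_single (⟨numZeros x, by omega⟩ : Fin (n + 1))]
        · simp
        · intro v _ hne
          rw [if_neg (c := numZeros x = v) (fun h => hne (Fin.ext h.symm)), mul_zero]
        · simp

/-! ### ### Counting gates and wires -/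

theorem card_bottomIndex_le (n d : ℕ) : Fintype.card (BottomIndex n d) ≤ (n + 1) ^ d := by
  classical
  -- Every set of at most `d` positions is listed by a map from `Fin d`, with `none` filling the
  -- unused places.
  let F (τ : Fin d → Option (Fin n)) : Finset (Fin n) :=
    Finset.univ.filter fun j => some j ∈ Set.range τ
  have hF : ∀ τ, (F τ).card ≤ d := by
    intro τ
    have : (F τ).map Function.Embedding.some ⊆ Finset.univ.image τ := by
      intro o ho
      simp only [F, Finset.mem_map, Finset.mem_filter, Finset.mem_univ, true_and] at ho
      obtain ⟨j, ⟨i, hi⟩, rfl⟩ := ho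
      exact Finset.mem_image.2 ⟨i, Finset.mem_univ _, hi⟩
    have h := Finset.card_le_card this
    rw [Finset.card_map] at h
    exact h.trans (Finset.card_image_le.trans (by simp))
  have hsurj : Function.Surjective fun τ => (⟨F τ, hF τ⟩ : BottomIndex n d) := by
    rintro ⟨S, hS⟩
    refine ⟨fun i => if h : i.1 < S.card then some (S.equivFin.symm ⟨i, h⟩).1 else none, ?_⟩
    refine Subtype.ext ?_
    ext j
    simp only [F, Finset.mem_filter, Finset.mem_univ, true_and, Set.mem_range]
    constructor
    · rintro ⟨i, hi⟩
      split_ifs at hi with h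
      rw [← Option.some.inj hi]
      exact (S.equivFin.symm ⟨i, h⟩).2
    · intro hj
      refine ⟨⟨S.equivFin ⟨j, hj⟩, (Fin.is_lt _).trans_le hS⟩, ?_⟩
      simp
  refine (Fintype.card_le_of_surjective _ hsurj).trans ?_
  simp

theorem card_middleIndex_le (n d r M : ℕ) [NeZero M] :
    Fintype.card (MiddleIndex n d r M) ≤ (n + 1) * ((n + 1) ^ d * M ^ (d + r)) * M := by
  rw [Fintype.card_prod, Fintype.card_prod, Fintype.card_sigma, ZMod.card, Fintype.card_fin,
    ← mul_assoc]
  gcongr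
  calc ∑ S : BottomIndex n d, Fintype.card (S.1 ⊕ Fin r → ZMod M)
      ≤ ∑ _S : BottomIndex n d, M ^ (d + r) := by
        refine Finset.sum_le_sum fun S _ => ?_
        rw [Fintype.card_fun, ZMod.card, Fintype.card_sum, Fintype.card_coe, Fintype.card_fin]
        exact Nat.pow_le_pow_right (Nat.pos_of_ne_zero (NeZero.ne M)) (by have := S.2; omega)
    _ ≤ _ := by
        rw [Finset.sum_const, Finset.card_univ, smul_eq_mul]
        gcongr
        exact card_bottomIndex_le n d

theorem exists_numZeros_eq {n : ℕ} {f : (Fin n → Bool) → Bool} (hf : IsSymmetricFn f) :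
    ∃ g : ℕ → Bool, ∀ x, f x = g (numZeros x) := by
  classical
  refine ⟨fun z => if h : ∃ x : Fin n → Bool, numZeros x = z then f h.choose else false,
    fun x => ?_⟩
  have h : ∃ y : Fin n → Bool, numZeros y = numZeros x := ⟨x, rfl⟩
  simp only [dif_pos h]
  have h1 := numZeros_add_hammingWeight x
  have h2 := numZeros_add_hammingWeight h.choose
  have h3 := h.choose_spec
  exact hf _ _ (by omega)

/-- With `Y = m * (n + 1)` and `X = Y ^ d`, there are at most `X` bottom gates and `X ^ 4` middle
gates. The total is a sum of six powers of `X` with exponents at most 6, hence at most `X ^ 7`. -/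
theorem circuit_size_le {n m d r M : ℕ} [NeZero M] (hn : 1 ≤ n) (hm : 2 ≤ m) (hMm : M ≤ m)
    (hd : 2 ≤ d) (hr : r ≤ d) :
    (Fintype.card (BottomIndex n d) + Fintype.card (BottomIndex n d) * (n * (m * m))) +
      (Fintype.card (MiddleIndex n d r M) +
        Fintype.card (MiddleIndex n d r M) * (Fintype.card (BottomIndex n d) * (m * m))) +
      (1 + Fintype.card (MiddleIndex n d r M) * (m * m)) ≤ (m * (n + 1)) ^ (7 * d) := by
  set Y := m * (n + 1) with hY
  have hY4 : 4 ≤ Y := by nlinarith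
  have hnY : n + 1 ≤ Y := Nat.le_mul_of_pos_left _ (by omega)
  have hmY : m ≤ Y := Nat.le_mul_of_pos_right _ (by omega)
  have hMY : M ≤ Y := hMm.trans hmY
  set X := Y ^ d with hX
  have hYX : Y ^ 2 ≤ X := Nat.pow_le_pow_right (by omega) hd
  have hX6 : 6 ≤ X := by nlinarith
  have hB : Fintype.card (BottomIndex n d) ≤ X :=
    (card_bottomIndex_le n d).trans (Nat.pow_le_pow_left hnY d)
  have hA : Fintype.card (MiddleIndex n d r M) ≤ X ^ 4 :=
    calc _ ≤ (n + 1) * ((n + 1) ^ d * M ^ (d + r)) * M := card_middleIndex_le n d r M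
      _ ≤ Y * (Y ^ d * Y ^ (d + r)) * Y := by gcongr
      _ = Y ^ (2 * d + r + 2) := by ring
      _ ≤ Y ^ (d * 4) := Nat.pow_le_pow_right (by omega) (by omega)
      _ = X ^ 4 := pow_mul _ _ _
  have hmm : m * m ≤ X := by nlinarith
  have hnX : n ≤ X := by nlinarith
  have hp : ∀ i, i ≤ 6 → X ^ i ≤ X ^ 6 := fun i hi => Nat.pow_le_pow_right (by omega) hi
  calc _ ≤ (X + X * (X * X)) + (X ^ 4 + X ^ 4 * (X * X)) + (1 + X ^ 4 * X) := by gcongr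
    _ = X ^ 1 + X ^ 3 + X ^ 4 + X ^ 6 + X ^ 0 + X ^ 5 := by ring
    _ ≤ 6 * X ^ 6 := by
        linarith [hp 1 (by omega), hp 3 (by omega), hp 4 (by omega), hp 0 (by omega),
          hp 5 (by omega)]
    _ ≤ X * X ^ 6 := Nat.mul_le_mul_right _ hX6
    _ = Y ^ (7 * d) := by rw [hX]; ring

/-! ### ### The circuits and the final size bound -/

/-- Every symmetric function has circuits whose size is governed by a number `s` with
`n < (s + 1) ^ (r + 1)`, where `r + 1` is the number of primes. -/
theorem hasModCircuit_of_isSymmetricFn {n r s m : ℕ} (hn : 1 ≤ n) (hr : 1 ≤ r) (hs : 1 ≤ s)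
    (hns : n < (s + 1) ^ (r + 1)) {p : Fin (r + 1) → ℕ} (hp : ∀ i, (p i).Prime)
    (hinj : Function.Injective p) (h0 : p 0 = 2) (hm : m = ∏ i, p i)
    {f : (Fin n → Bool) → Bool} (hf : IsSymmetricFn f) {S : ℝ}
    (hS : (((m * (n + 1)) ^ (7 * (m * s)) : ℕ) : ℝ) ≤ S) :
    HasModCircuit [m, m, m] f S ∧ HasModCircuit [p 0, ∏ i : Fin r, p i.succ, p 0] f S := by
  obtain ⟨g, hg⟩ := exists_numZeros_eq hf
  have hpm : ∀ i, p i ∣ m := fun i => hm ▸ Finset.dvd_prod_of_mem p (Finset.mem_univ i)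
  have hm0 : 0 < m := hm ▸ Finset.prod_pos fun i _ => (hp i).pos
  have hm2 : 2 ≤ m := Nat.le_of_dvd hm0 (h0 ▸ hpm 0)
  have hrm : r < m := by
    calc r < 2 ^ r := Nat.lt_two_pow_self
      _ ≤ 2 ^ (r + 1) := Nat.pow_le_pow_right (by norm_num) (by omega)
      _ = ∏ _i : Fin (r + 1), 2 := by simp
      _ ≤ m := hm ▸ Finset.prod_le_prod' fun i _ => (hp i).two_le
  set M := ∏ i : Fin r, p i.succ with hM
  have hMm : M ∣ m := by rw [hm, Fin.prod_univ_succ]; exact Dvd.intro_left _ rfl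
  have hMle : M ≤ m := Nat.le_of_dvd hm0 hMm
  have : NeZero M := ⟨fun h => by rw [h, zero_dvd_iff] at hMm; omega⟩
  -- The exponent is the least one with `p i ^ e > s`, so that `p i ^ e ≤ p i * s ≤ m * s`. The
  -- parities therefore read at most `d = m * s` inputs.
  have hd : ∀ i, p i ^ (Nat.log (p i) s + 1) ≤ m * s := fun i => by
    rw [pow_succ, mul_comm]
    exact Nat.mul_le_mul (Nat.le_of_dvd hm0 (hpm i)) (Nat.pow_log_le_self _ (by omega))
  have hnd : n < ∏ i, p i ^ (Nat.log (p i) s + 1) :=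
    calc n < (s + 1) ^ (r + 1) := hns
      _ = ∏ _i : Fin (r + 1), (s + 1) := by simp
      _ ≤ _ := Finset.prod_le_prod' fun i _ => Nat.lt_pow_succ_log_self (hp i).one_lt s
  have hms : m ≤ m * s := Nat.le_mul_of_pos_right _ hs
  obtain ⟨w, t, hwt⟩ := exists_middle_weights hr hp hinj h0 _ hd hnd hM g
  have hsize := circuit_size_le hn hm2 hMle (hm2.trans hms) (hrm.le.trans hms)
  rw [h0]
  refine ModCircuit.exists_three_layer_pair 2 M 2 m hm0 (h0 ▸ hpm 0) hMm (h0 ▸ hpm 0)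
    (fun (β : BottomIndex n (m * s)) j => if j ∈ β.1 then 1 else 0)
    (fun α β => (w α β).val) (fun α => (t α).val) (fun β j => ?_) (fun α β => ?_) (fun α => ?_)
    f (fun x => ?_) S (le_trans ?_ hS)
  · split_ifs <;> omega
  · exact (ZMod.val_lt _).le.trans hMle
  · exact (ZMod.val_lt _).le.trans hm2
  · have hbot : ∀ β : BottomIndex n (m * s),
        (((decide (2 ∣ ∑ j, (if j ∈ β.1 then 1 else 0) * (x j).toNat)).toNat : ℕ) : ZMod M) =
          parityInd (ZMod M) β.1 x := by
      intro β
      simp only [ite_mul, one_mul, zero_mul, Finset.sum_ite_mem, Finset.univ_inter, parityInd]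
      split_ifs with h <;> simp [h]
    have hmid : ∀ α, (M ∣ ∑ β, (w α β).val *
        (decide (2 ∣ ∑ j, (if j ∈ β.1 then 1 else 0) * (x j).toNat)).toNat) ↔
          ∑ β, w α β * parityInd (ZMod M) β.1 x = 0 := by
      intro α
      rw [← ZMod.natCast_eq_zero_iff]
      push_cast
      simp only [hbot, ZMod.natCast_zmod_val]
    simp only [hmid]
    rw [hg]
    have htop := hwt x
    have hcast : ((∑ α, (t α).val * (decide (∑ β, w α β * parityInd (ZMod M) β.1 x = 0)).toNat :
        ℕ) : ZMod 2) = if g (numZeros x) then 0 else 1 := by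
      rw [← htop]
      push_cast
      refine Finset.sum_congr rfl fun α _ => ?_
      rw [ZMod.natCast_zmod_val]
      congr 1
      split_ifs with h <;> simp [h]
    simp only [← ZMod.natCast_eq_zero_iff, hcast]
    cases g (numZeros x) <;> simp
  · exact_mod_cast hsize

/-- With `s = ⌊n ^ (1 / k)⌋₊` the logarithm of the size is `O(n ^ (1 / k) * log n)`. Since `δ = ε -
1 / k` is positive, `log n ≤ n ^ δ / δ` absorbs the logarithm. -/
theorem exists_pow_le_exp {ε : ℝ} {k : ℕ} (hk : 1 ≤ k) (hε : 1 < ε * k) {m : ℕ} (hm : 1 ≤ m) :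
    ∃ c : ℝ, 0 < c ∧ ∀ n : ℕ, 1 ≤ n → ∃ s : ℕ, 1 ≤ s ∧ n < (s + 1) ^ k ∧
      (((m * (n + 1)) ^ (7 * (m * s)) : ℕ) : ℝ) ≤ Real.exp (c * (n : ℝ) ^ ε) := by
  have hk0 : (0 : ℝ) < k := by exact_mod_cast hk
  have hm0 : (0 : ℝ) < m := by exact_mod_cast hm
  have hδ : 0 < ε - 1 / k := by rw [sub_pos, div_lt_iff₀ hk0]; exact hε
  set δ := ε - 1 / k with hδe
  refine ⟨7 * m * (2 * m + 1 / δ), by positivity, fun n hn => ?_⟩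
  have hn1 : (1 : ℝ) ≤ n := by exact_mod_cast hn
  have hn0 : (0 : ℝ) < n := by linarith
  have hroot : (1 : ℝ) ≤ (n : ℝ) ^ (1 / k : ℝ) := Real.one_le_rpow hn1 (by positivity)
  have hnδ : (1 : ℝ) ≤ (n : ℝ) ^ δ := Real.one_le_rpow hn1 hδ.le
  refine ⟨⌊(n : ℝ) ^ (1 / k : ℝ)⌋₊, Nat.le_floor (by simpa using hroot), ?_, ?_⟩
  · have h : (n : ℝ) < (⌊(n : ℝ) ^ (1 / k : ℝ)⌋₊ + 1) ^ k :=
      calc (n : ℝ) = ((n : ℝ) ^ (1 / k : ℝ)) ^ k := by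
            rw [← Real.rpow_natCast, ← Real.rpow_mul hn0.le, one_div_mul_cancel hk0.ne',
              Real.rpow_one]
        _ < _ := pow_lt_pow_left₀ (Nat.lt_floor_add_one _) (by positivity) (by omega)
    exact_mod_cast h
  · set s := ⌊(n : ℝ) ^ (1 / k : ℝ)⌋₊
    have hs : (s : ℝ) ≤ (n : ℝ) ^ (1 / k : ℝ) := Nat.floor_le (by positivity)
    have hYpos : (0 : ℝ) < m * (n + 1) := by positivity
    have hlog : Real.log (m * (n + 1)) ≤ (2 * m + 1 / δ) * (n : ℝ) ^ δ :=
      calc Real.log (m * (n + 1)) ≤ Real.log (2 * m * n) :=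
            Real.log_le_log hYpos (by nlinarith)
        _ = Real.log (2 * m) + Real.log n := Real.log_mul (by positivity) (by positivity)
        _ ≤ 2 * m + (n : ℝ) ^ δ / δ :=
            add_le_add (Real.log_le_self (by positivity)) (Real.log_le_rpow_div hn0.le hδ)
        _ ≤ 2 * m * (n : ℝ) ^ δ + (n : ℝ) ^ δ / δ := by
            exact add_le_add_left (le_mul_of_one_le_right (by positivity) hnδ) _
        _ = _ := by ring
    push_cast
    rw [← Real.exp_log hYpos, ← Real.exp_nat_mul, Real.exp_le_exp]
    push_cast
    have hY1 : 0 ≤ Real.log (m * (n + 1)) := by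
      have hm1 : (1 : ℝ) ≤ m := by exact_mod_cast hm
      exact Real.log_nonneg (by nlinarith)
    calc 7 * ((m : ℝ) * s) * Real.log (m * (n + 1))
        ≤ 7 * ((m : ℝ) * (n : ℝ) ^ (1 / k : ℝ)) * ((2 * m + 1 / δ) * (n : ℝ) ^ δ) := by gcongr
      _ = 7 * m * (2 * m + 1 / δ) * ((n : ℝ) ^ (1 / k : ℝ) * (n : ℝ) ^ δ) := by ring
      _ = _ := by
          rw [← Real.rpow_add hn0, hδe]
          congr 2
          ring

theorem theorem1 :
    ∀ ε : ℝ, 0 < ε →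
      ∃ (m r : ℕ) (p : Fin (r + 1) → ℕ),
        1 ≤ r ∧ (∀ i, (p i).Prime) ∧ Function.Injective p ∧ m = ∏ i, p i ∧
        (ε ≤ 1 / 2 → (m : ℝ) ≤ max 30 ((1 / ε) ^ (2 / ε))) ∧
        (1 / 2 < ε → (m : ℝ) ≤ max 6 ((1 / ε) ^ (2 / ε))) ∧
        ∃ c : ℝ, 0 < c ∧
          ∀ n : ℕ, 1 ≤ n → ∀ f : (Fin n → Bool) → Bool, IsSymmetricFn f →
            HasModCircuit [m, m, m] f (Real.exp (c * (n : ℝ) ^ ε)) ∧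
            HasModCircuit [p 0, ∏ i : Fin r, p i.succ, p 0] f
              (Real.exp (c * (n : ℝ) ^ ε)) := by
  intro ε hε
  obtain ⟨r, hr, hεr, hsmall, hlarge⟩ := exists_prod_nth_prime_le hε
  have hp : ∀ i : Fin (r + 1), (Nat.nth Nat.Prime i).Prime := fun i => Nat.prime_nth_prime i
  have hinj : Function.Injective fun i : Fin (r + 1) => Nat.nth Nat.Prime i :=
    (Nat.nth_injective Nat.infinite_setOfPred_prime).comp Fin.val_injective
  obtain ⟨c, hc, hcn⟩ := exists_pow_le_exp (k := r + 1) (by omega) (by exact_mod_cast hεr)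
    (Finset.prod_pos fun (i : Fin (r + 1)) (_ : i ∈ Finset.univ) => (hp i).pos)
  refine ⟨_, r, fun i => Nat.nth Nat.Prime i, hr, hp, hinj, rfl, hsmall, hlarge, c, hc,
    fun n hn f hf => ?_⟩
  obtain ⟨s, hs, hns, hS⟩ := hcn n hn
  exact hasModCircuit_of_isSymmetricFn hn hr hs hns hp hinj Nat.nth_prime_zero_eq_two rfl hf hS
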